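/- **Setting.** Let $\beta\ge\sqrt2$, $\alpha=\arcsin\frac1{2\beta}$, $c_{gbu}=(2\beta)^{\pi/\alpha}$, let $c_{low}>0$, $c_{up}\ge 2c_{low}$, $c_{shrink}>0$ be constants, and put $c_{low}'=c_{shrink}c_{low}$, $c_{reach}=2c_{up}c_{gbu}$, $c_{span}=\log_2\frac{c_{gbu}c_{up}}{c_{low}'}+1$. For a point set $P$ in the plane, $\mathrm{lfs}_P(x)$ is the radius of the smallest disk centered at $x$ that touches two points of $P$. For $p\ne q$ the left leaf of $pq$ is the disk of radius $\beta|pq|$ with $p,q$ on its boundary whose center lies to the left of $pq$; the right leaf of $pq$ is the left leaf of $qp$. The pair $pq$ is *loose* in $P$ if the interior of one of its leaves contains no point of $P$. Let $c$ be the point of the boundary of this empty leaf furthest from $pq$. The *off-center* of $pq$ is $c$ if the crescent (the open disk centered at $c$ through $p$ and $q$, minus the interior of the leaf) contains no point of $P$, and otherwise it is the circumcenter of $pqw$, where $w\in P$ lies in the crescent and the open circumdisk of $pqw$ contains no point of $P$. Only off-centers in $[0,1]^2$ are considered. **Algorithm.** The input is a finite set $\Omega\subseteq[1/3,2/3]^2$.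 Each edge of $[0,1]^2$ is split into three boundary segments, and $P$ initially consists of $\Omega$ and the endpoints of these segments. Let $\mathcal{QT}$ be a balanced quadtree with root $[0,1]^2$ and depth $d_{\mathcal{QT}}$ (leaves that share a piece of an edge differ in size by a factor at most $2$), such that each initial vertex $p$ is stored in a leaf $\Box\ni p$ with $c_{low}\,\mathrm{size}(\Box)\le \mathrm{lfs}_P(p)\le c_{up}\,\mathrm{size}(\Box)$. The activation depth $\mathrm{act}(p)$ of a vertex $p$ is the depth of the cell in which it is stored when it becomes a vertex; $p$ is *active* at depth $j$ if $\mathrm{act}(p)\ge j\ge \mathrm{act}(p)-c_{span}$. A heap initially holds all nodes of $\mathcal{QT}$. While it is not empty, a smallest node $\Box$ is extracted; let $j$ be its depth. For every vertex $p\in\Box$ active at depth $j$ and every vertex $q\neq p$ active at depth $j$ with $|pq|\le c_{reach}\,\mathrm{size}(\Box)$, it is tested whether $pq$ is loose. If it is, an off-center $r$ of $pq$ is inserted into $P$ and stored in a deepest node $\Box'\ni r$ of $\mathcal{QT}$ with $c_{low}\,\mathrm{size}(\Box')\le|pr|\le c_{up}\,\mathrm{size}(\Box')$ and $\mathrm{size}(\Box')\ge\mathrm{size}(\Box)$;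 if $\Box'$ has depth $j$, it is reinserted into the heap. If, however, $r$ lies inside the diametral circle of a boundary segment, then $r$ is not inserted; instead such a segment is split at its midpoint $m$, which becomes a vertex stored by the same rule with $\mathrm{lfs}_{P\cup\{m\}}(m)$ in place of $|pr|$, and $pq$ is tested again. Stage $i$ of the execution is the part in which the nodes of depth $d_{\mathcal{QT}}-i$ are handled. **Lemma.** At any stage $i$, the number of active points inside a cell at level $d_{\mathcal{QT}}-i$ is $O(1)$. That is, there is a constant $K$, depending only on $\beta,c_{low},c_{up},c_{shrink}$, such that for every $\Omega$, every $\mathcal{QT}$ as above, every execution of the algorithm, every $i$ and every moment of stage $i$, each cell of $\mathcal{QT}$ of depth $d_{\mathcal{QT}}-i$ contains at most $K$ vertices that are active at depth $d_{\mathcal{QT}}-i$. -/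

import Mathlib

noncomputable section

namespace DelaunayQT

/-- The Euclidean plane. -/
abbrev Plane : Type := EuclideanSpace ℝ (Fin 2)

/-! ### Constants -/

/-- The numerical parameters: the radius-edge threshold `β`, the constants `cLow`, `cUp` comparing
local feature size and cell size, and the shrinking constant `cShrink`. -/
structure Consts where
  β : ℝ
  cLow : ℝ
  cUp : ℝ
  cShrink : ℝ

/-- The small-angle threshold `α = arcsin (1 / (2 β))`. -/
def Consts.α (C : Consts) : ℝ := Real.arcsin (1 / (2 * C.β))

/-- `c_gbu = (2 β) ^ (π / α)`. -/
def Consts.cGbu (C : Consts) : ℝ := (2 * C.β) ^ (Real.pi / C.α)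

/-- `c_low' = c_shrink * c_low`. -/
def Consts.cLow' (C : Consts) : ℝ := C.cShrink * C.cLow

/-- `c_reach = 2 * c_up * c_gbu`. -/
def Consts.cReach (C : Consts) : ℝ := 2 * C.cUp * C.cGbu

/-- `c_span = lg (c_gbu * c_up / c_low') + 1`. -/
def Consts.cSpan (C : Consts) : ℝ := Real.logb 2 (C.cGbu * C.cUp / C.cLow') + 1

/-! ### Local feature size, loose pairs and off-centers -/

/-- Local feature size of `x` with respect to a point set `P`: the radius of the smallest disk
centered at `x` that touches two points of `P`. -/
def lfs (P : Set Plane) (x : Plane) : ℝ :=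
  sInf {ρ : ℝ | 0 ≤ ρ ∧ (P ∩ Metric.closedBall x ρ).Nontrivial}

/-- Counterclockwise rotation by a right angle. -/
def rot (v : Plane) : Plane := !₂[-v 1, v 0]

/-- The center `u` of the left leaf of the flower of `pq`: `pqu` is a left turn and
`|up| = |uq| = β |pq|`. -/
def leafCenter (β : ℝ) (p q : Plane) : Plane :=
  midpoint ℝ p q + Real.sqrt (β ^ 2 - 1 / 4) • rot (q - p)

/-- The left leaf of the flower of `pq` (without its boundary circle, which carries `p` and `q`).
The right leaf of `pq` is the left leaf of `qp`. -/
def leaf (β : ℝ) (p q : Plane) : Set Plane := Metric.ball (leafCenter β p q) (β * dist p q)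

/-- The point of the boundary of the left leaf of `pq` which is furthest from `pq`. -/
def leafTip (β : ℝ) (p q : Plane) : Plane :=
  leafCenter β p q + β • rot (q - p)

/-- The left crescent of `pq`: the disk centered at the tip of the leaf with `p` and `q` on its
boundary, minus the leaf. -/
def crescent (β : ℝ) (p q : Plane) : Set Plane :=
  Metric.ball (leafTip β p q) (dist (leafTip β p q) p) \ leaf β p q

/-- `w` is a moonstruck point of `pq` (left side), and `c` is the circumcenter of `pqw`: the vertex
`w` lies in the crescent and the circumdisk of `pqw` is empty of vertices. -/
def Moonstruck (β : ℝ) (P : Set Plane) (p q w c : Plane) : Prop :=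
  w ∈ P ∧ w ∈ crescent β p q ∧ dist c p = dist c q ∧ dist c p = dist c w ∧
    Disjoint P (Metric.ball c (dist c p))

/-- The left leaf of `pq` is empty of vertices and `r` is the corresponding off-center: the tip of
the leaf if the crescent is empty, otherwise the circumcenter of `pqw` with `w` moonstruck. -/
def LeftOffCenter (β : ℝ) (P : Set Plane) (p q r : Plane) : Prop :=
  Disjoint P (leaf β p q) ∧
    ((Disjoint P (crescent β p q) ∧ r = leafTip β p q) ∨ ∃ w, Moonstruck β P p q w r)

/-- The bounding square `B = [0,1]²`. -/
def unitSquare : Set Plane := {p | ∀ k, 0 ≤ p k ∧ p k ≤ 1}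

/-- The square `[1/3,2/3]²`, which contains the input. -/
def innerSquare : Set Plane := {p | ∀ k, 1 / 3 ≤ p k ∧ p k ≤ 2 / 3}

/-- `pq` is a loose pair of `P` (its left or its right leaf is empty) and `r` is an off-center
of `pq`. The domain is the square `B`: the side of a boundary segment that faces
away from `B` is not part of it, which is what `r ∈ unitSquare` excludes. -/
def OffCenter (β : ℝ) (P : Set Plane) (p q r : Plane) : Prop :=
  p ≠ q ∧ r ∈ unitSquare ∧ (LeftOffCenter β P p q r ∨ LeftOffCenter β P q p r)

/-- `pq` is a loose pair of `P`. -/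
def Loose (β : ℝ) (P : Set Plane) (p q : Plane) : Prop := ∃ r, OffCenter β P p q r

/-! ### The boundary of the square -/

/-- The corners of `B`, counterclockwise. -/
def corner : Fin 4 → Plane := ![!₂[0, 0], !₂[1, 0], !₂[1, 1], !₂[0, 1]]

/-- The point at fraction `k / 3` of the `e`-th edge of `B`. -/
def edgePoint (e : Fin 4) (k : ℕ) : Plane :=
  AffineMap.lineMap (corner e) (corner (e + 1)) ((k : ℝ) / 3)

/-- The twelve segments into which the edges of `B` are split at the beginning. -/
def initialSegments : Set (Plane × Plane) :=
  {s | ∃ e : Fin 4, ∃ k < 3, s = (edgePoint e k, edgePoint e (k + 1))}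

/-- The endpoints of these segments. -/
def initialBoundary : Set Plane := {x | ∃ e : Fin 4, ∃ k < 3, x = edgePoint e k}

/-- `x` encroaches the segment `ab`: it is inside the diametral circle of `ab`. -/
def Encroaches (x a b : Plane) : Prop := dist x (midpoint ℝ a b) < dist a b / 2

/-! ### Quadtrees -/

/-- The dyadic square `[x / 2^depth, (x+1) / 2^depth] × [y / 2^depth, (y+1) / 2^depth]`. -/
@[ext] structure Cell where
  depth : ℕ
  x : ℕ
  y : ℕ

/-- Side length of a cell. -/
def Cell.size (b : Cell) : ℝ := (1 / 2) ^ b.depth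

/-- The closed square occupied by a cell. -/
def Cell.square (b : Cell) : Set Plane :=
  {p | b.x * b.size ≤ p 0 ∧ p 0 ≤ (b.x + 1) * b.size ∧
    b.y * b.size ≤ p 1 ∧ p 1 ≤ (b.y + 1) * b.size}

/-- `c` is one of the four quadrants of `b`. -/
def Cell.IsChild (c b : Cell) : Prop := c.depth = b.depth + 1 ∧ c.x / 2 = b.x ∧ c.y / 2 = b.y

/-- A (finite) quadtree with root `[0,1]²`: every other node is a child of a node, and with a child
of a node all four children are nodes. -/
structure Quadtree where
  nodes : Finset Cell
  root_mem : (⟨0, 0, 0⟩ : Cell) ∈ nodes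
  parent_mem : ∀ c ∈ nodes, c = ⟨0, 0, 0⟩ ∨ ∃ b ∈ nodes, c.IsChild b
  siblings_mem : ∀ b c c' : Cell, c.IsChild b → c'.IsChild b → c ∈ nodes → c' ∈ nodes

/-- The leaves of a quadtree. -/
def Quadtree.IsLeaf (QT : Quadtree) (b : Cell) : Prop :=
  b ∈ QT.nodes ∧ ∀ c ∈ QT.nodes, ¬ c.IsChild b

/-- The depth `d_QT` of a quadtree. -/
def Quadtree.depth (QT : Quadtree) : ℕ := QT.nodes.sup Cell.depth

/-- Two leaves that share a piece of an edge have the same size up to a factor two. -/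
def Quadtree.Balanced (QT : Quadtree) : Prop :=
  ∀ a b : Cell, QT.IsLeaf a → QT.IsLeaf b → a ≠ b → (a.square ∩ b.square).Nontrivial →
    a.size ≤ 2 * b.size

/-! ### The algorithm -/

/-- Position in the main loop: between two nodes; handling the node `b`, where `T` are the vertices
`p` not yet visited by the outer loop; or inside the inner loop for `p`, where moreover `U` are the
vertices `q` not yet visited by the inner loop. -/
inductive Phase where
  | idle : Phase
  | outer (b : Cell) (T : Set Plane) : Phase
  | inner (b : Cell) (T : Set Plane) (p : Plane) (U : Set Plane) : Phase

/-- State of the algorithm. -/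
structure State where
  /-- the current point set `P` -/
  P : Set Plane
  /-- the cell into which a vertex was inserted -/
  store : Plane → Cell
  /-- the current segments of the boundary of `B` -/
  segs : Set (Plane × Plane)
  /-- the nodes in the heap -/
  heap : Set Cell
  /-- the depth of the nodes that are being handled (the variable `prev_i`) -/
  level : ℕ
  phase : Phase

/-- The activation depth of a vertex: the depth of the cell it was inserted into. -/
def State.act (s : State) (p : Plane) : ℕ := (s.store p).depth

/-- `p` is a vertex that is active at depth `i`: `act p ≥ i ≥ act p - c_span`. -/
def State.Active (C : Consts) (s : State) (p : Plane) (i : ℕ) : Prop :=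
  p ∈ s.P ∧ i ≤ s.act p ∧ (s.act p : ℝ) - C.cSpan ≤ i

/-- While `b` is handled, a new vertex `r` at distance `d` from the nearest vertices
may be stored in the node `b'`. -/
def CanStore (C : Consts) (QT : Quadtree) (b : Cell) (r : Plane) (d : ℝ) (b' : Cell) : Prop :=
  b' ∈ QT.nodes ∧ r ∈ b'.square ∧ C.cLow * b'.size ≤ d ∧ d ≤ C.cUp * b'.size ∧ b.size ≤ b'.size

/-- `b'` is a lowest node in which the new vertex may be stored. -/
def StoreCell (C : Consts) (QT : Quadtree) (b : Cell) (r : Plane) (d : ℝ) (b' : Cell) : Prop :=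
  CanStore C QT b r d b' ∧ ∀ b'', CanStore C QT b r d b'' → b''.depth ≤ b'.depth

open Classical in
/-- Insert the vertex `r` into the point set, store it in `b'`, and, if `b'` is on the level of the
node `b` that is being handled, reinsert `b'` into the heap. -/
def State.addVertex (s : State) (b : Cell) (r : Plane) (b' : Cell) : State :=
  { s with
    P := insert r s.P
    store := Function.update s.store r b'
    heap := if b'.depth = b.depth then insert b' s.heap else s.heap }

/-- The states in which the algorithm may start on the input `Ω` with the quadtree `QT`. The
vertices are the input points and the endpoints of the boundary segments; each is
stored in a leaf that contains it and whose size is comparable to its local feature size. -/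
structure Initial (C : Consts) (QT : Quadtree) (Ω : Set Plane) (s : State) : Prop where
  P_eq : s.P = Ω ∪ initialBoundary
  store_leaf : ∀ p ∈ s.P, QT.IsLeaf (s.store p) ∧ p ∈ (s.store p).square ∧
    C.cLow * (s.store p).size ≤ lfs s.P p ∧ lfs s.P p ≤ C.cUp * (s.store p).size
  segs_eq : s.segs = initialSegments
  heap_eq : s.heap = QT.nodes
  level_eq : s.level = QT.depth
  phase_eq : s.phase = Phase.idle

/-- One step of the algorithm. The two loops run over the active vertices present when the
loop is entered, in any order. -/
inductive Step (C : Consts) (QT : Quadtree) : State → State → Prop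
  /-- Extract a smallest node `b` from the heap and enter the outer loop. -/
  | pop (s : State) (b : Cell) (hphase : s.phase = .idle) (hb : b ∈ s.heap)
      (hmin : ∀ b' ∈ s.heap, b.size ≤ b'.size) :
      Step C QT s { s with
        heap := s.heap \ {b}
        level := b.depth
        phase := .outer b {p | s.Active C p b.depth ∧ p ∈ b.square} }
  /-- Take the next vertex `p` of the outer loop and enter the inner loop. -/
  | next (s : State) (b : Cell) (T : Set Plane) (p : Plane) (hphase : s.phase = .outer b T)
      (hp : p ∈ T) :
      Step C QT s { s with
        phase := .inner b (T \ {p}) p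
          {q | q ≠ p ∧ s.Active C q b.depth ∧ dist p q ≤ C.cReach * b.size} }
  /-- The pair `pq` is not loose: nothing to do. -/
  | skip (s : State) (b : Cell) (T : Set Plane) (p : Plane) (U : Set Plane) (q : Plane)
      (hphase : s.phase = .inner b T p U) (hq : q ∈ U) (hloose : ¬ Loose C.β s.P p q) :
      Step C QT s { s with phase := .inner b T p (U \ {q}) }
  /-- The pair `pq` is loose and its off-center `r` encroaches no boundary segment:
  insert `r`. -/
  | refine (s : State) (b : Cell) (T : Set Plane) (p : Plane) (U : Set Plane) (q r : Plane)
      (b' : Cell) (hphase : s.phase = .inner b T p U) (hq : q ∈ U)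
      (hr : OffCenter C.β s.P p q r) (hfree : ∀ e ∈ s.segs, ¬ Encroaches r e.1 e.2)
      (hstore : StoreCell C QT b r (dist p r) b') :
      Step C QT s { s.addVertex b r b' with phase := .inner b T p (U \ {q}) }
  /-- The pair `pq` is loose and its off-center `r` encroaches a boundary segment `e`: do not
  insert `r`, but split `e` in the middle. The pair `pq` stays in the loop, to be tested again. -/
  | split (s : State) (b : Cell) (T : Set Plane) (p : Plane) (U : Set Plane) (q r : Plane)
      (e : Plane × Plane) (m : Plane) (b' : Cell) (hphase : s.phase = .inner b T p U) (hq : q ∈ U)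
      (hr : OffCenter C.β s.P p q r) (he : e ∈ s.segs) (henc : Encroaches r e.1 e.2)
      (hm : m = midpoint ℝ e.1 e.2)
      (hstore : StoreCell C QT b m (lfs (insert m s.P) m) b') :
      Step C QT s { s.addVertex b m b' with
        segs := (s.segs \ {e}) ∪ {(e.1, m), (m, e.2)} }
  /-- End of the inner loop. -/
  | endInner (s : State) (b : Cell) (T : Set Plane) (p : Plane)
      (hphase : s.phase = .inner b T p ∅) :
      Step C QT s { s with phase := .outer b T }
  /-- End of the outer loop. -/
  | endOuter (s : State) (b : Cell) (hphase : s.phase = .outer b ∅) :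
      Step C QT s { s with phase := .idle }

/-- `s` is a state that occurs in some execution of the algorithm on the input `Ω` with the
initial quadtree `QT`. -/
def Occurs (C : Consts) (QT : Quadtree) (Ω : Set Plane) (s : State) : Prop :=
  ∃ s₀, Initial C QT Ω s₀ ∧ Relation.ReflTransGen (Step C QT) s₀ s

end DelaunayQT

end

namespace DelaunayQT

/-! ### Empty disks around new vertices -/

/-! The proof is a packing argument resting on an invariant of the execution, `State.Separated`. A
vertex is stored in a cell whose size is at most `1 / cLow` times its distance to every other vertex
present at that moment. For initial vertices and midpoints this is the lower bound on the local
feature size; for an off-center `r` of `pq` it holds because the disk about `r` through `p` and `q`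
has no vertex inside, so `|pr|` is the distance from `r` to the vertex set (`OffCenter.dist_le`).
For a given pair only the later vertex is sure to give the bound, whence the disjunction.

A vertex active at the depth of `b` lies at most `cSpan` levels deeper, so its cell has size at
least `2 ^ (-cSpan) * b.size` (`State.Active.le_size`). The active vertices in `b` are therefore
pairwise separated by a fixed multiple of `b.size`, and a grid count (`Cell.encard_le_of_separated`)
bounds their number. -/

lemma dist_leafTip (β : ℝ) (p q : Plane) : dist (leafTip β p q) p = dist (leafTip β p q) q := by
  rw [EuclideanSpace.dist_eq, EuclideanSpace.dist_eq]
  congr 1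
  simp only [leafTip, leafCenter, rot, midpoint_eq_smul_add, Fin.sum_univ_two, Real.dist_eq,
    sq_abs, PiLp.add_apply, PiLp.smul_apply, PiLp.sub_apply, smul_eq_mul,
    Matrix.cons_val_zero, Matrix.cons_val_one, invOf_eq_inv]
  ring

/-- An off-center is the center of an empty disk with `p` and `q` on its boundary. -/
lemma LeftOffCenter.empty_disk {β : ℝ} {P : Set Plane} {p q r : Plane}
    (h : LeftOffCenter β P p q r) : dist r p = dist r q ∧ ∀ x ∈ P, dist r p ≤ dist r x := by
  obtain ⟨hleaf, ⟨hcres, rfl⟩ | ⟨w, -, -, hpq, -, hball⟩⟩ := h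
  · refine ⟨dist_leafTip β p q, fun x hx => ?_⟩
    by_contra! hlt
    -- The leaf and the crescent together cover the disk about the tip, and both are free of
    -- vertices.
    refine Set.disjoint_left.1 hcres hx ⟨?_, Set.disjoint_left.1 hleaf hx⟩
    rwa [Metric.mem_ball, dist_comm]
  · refine ⟨hpq, fun x hx => ?_⟩
    by_contra! hlt
    refine Set.disjoint_left.1 hball hx ?_
    rwa [Metric.mem_ball, dist_comm]

lemma OffCenter.dist_le {β : ℝ} {P : Set Plane} {p q r x : Plane}
    (h : OffCenter β P p q r) (hx : x ∈ P) : dist p r ≤ dist r x := by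
  rw [dist_comm p r]
  obtain ⟨-, -, h | h⟩ := h
  · exact h.empty_disk.2 x hx
  · exact h.empty_disk.1 ▸ h.empty_disk.2 x hx

lemma lfs_le_dist {P : Set Plane} {x y : Plane} (hx : x ∈ P) (hy : y ∈ P) (hne : x ≠ y) :
    lfs P x ≤ dist x y := by
  refine csInf_le ⟨0, fun ρ hρ => hρ.1⟩ ⟨dist_nonneg, x, ⟨hx, ?_⟩, y, ⟨hy, ?_⟩, hne⟩
  · exact Metric.mem_closedBall_self dist_nonneg
  · rw [Metric.mem_closedBall, dist_comm]

/-! ### Separation of the vertices -/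

/-- Any two vertices are separated by a distance proportional to the size of the cell in which one
of them is stored. -/
def State.Separated (C : Consts) (s : State) : Prop :=
  ∀ x ∈ s.P, ∀ y ∈ s.P, x ≠ y →
    C.cLow * (s.store x).size ≤ dist x y ∨ C.cLow * (s.store y).size ≤ dist x y

lemma Initial.separated {C : Consts} {QT : Quadtree} {Ω : Set Plane} {s : State}
    (h : Initial C QT Ω s) : s.Separated C := fun x hx _ hy hne =>
  .inl ((h.store_leaf x hx).2.2.1.trans (lfs_le_dist hx hy hne))

/-- Only pairs containing `r` need a new bound. Should `r` already be a vertex, its old cell is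
overwritten, but `hr` covers all its pairs. -/
lemma State.Separated.addVertex {C : Consts} {s : State} (h : s.Separated C) {b b' : Cell}
    {r : Plane} (hr : ∀ x ∈ s.P, x ≠ r → C.cLow * b'.size ≤ dist r x) :
    (s.addVertex b r b').Separated C := by
  intro x hx y hy hne
  simp only [State.addVertex, Set.mem_insert_iff] at hx hy ⊢
  by_cases hxr : x = r
  · subst hxr
    left
    simpa using hr y (hy.resolve_left hne.symm) hne.symm
  · by_cases hyr : y = r
    · subst hyr
      right
      simpa [dist_comm] using hr x (hx.resolve_left hxr) hxr
    · simpa [Function.update_of_ne hxr, Function.update_of_ne hyr] using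
        h x (hx.resolve_left hxr) y (hy.resolve_left hyr) hne

lemma Step.separated {C : Consts} {QT : Quadtree} {s t : State} (hst : Step C QT s t)
    (h : s.Separated C) : t.Separated C := by
  cases hst with
  | pop | next | skip | endInner | endOuter => exact h
  | refine b T p U q r b' _ _ hr _ hstore =>
    have := h.addVertex (b := b) fun x hx _ => hstore.1.2.2.1.trans (hr.dist_le hx)
    exact this
  | split b T p U q r e m b' _ _ _ _ _ _ hstore =>
    -- The local feature size is taken with `m` already inserted, so `m` and `x` are two points that
    -- bound it by their distance.
    have := h.addVertex (b := b) fun x hx hne => hstore.1.2.2.1.trans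
      (lfs_le_dist (Set.mem_insert m s.P) (Set.mem_insert_of_mem m hx) hne.symm)
    exact this

lemma Occurs.separated {C : Consts} {QT : Quadtree} {Ω : Set Plane} {s : State}
    (h : Occurs C QT Ω s) : s.Separated C := by
  obtain ⟨s₀, h₀, hs⟩ := h
  induction hs with
  | refl => exact h₀.separated
  | tail _ hstep ih => exact hstep.separated ih

lemma Cell.size_pos (b : Cell) : 0 < b.size := by
  unfold Cell.size
  positivity

/-- Only the upper bound `act p ≤ b.depth + cSpan` matters. Sizes become real powers of `1/2`
because `cSpan` need not be an integer. -/
lemma State.Active.le_size {C : Consts} {s : State} {p : Plane} {b : Cell}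
    (h : s.Active C p b.depth) : (1 / 2 : ℝ) ^ C.cSpan * b.size ≤ (s.store p).size := by
  unfold Cell.size
  rw [← Real.rpow_natCast, ← Real.rpow_natCast, ← Real.rpow_add (by norm_num)]
  refine Real.rpow_le_rpow_of_exponent_ge (by norm_num) (by norm_num) ?_
  have := h.2.2
  unfold State.act at this
  linarith

/-! ### Packing -/

lemma dist_lt_of_abs_lt {x y : Plane} {ε : ℝ} (h : ∀ k, |x k - y k| < ε / 2) : dist x y < ε := by
  have h0 := h 0
  have h1 := h 1
  have hε : 0 < ε := by linarith [abs_nonneg (x 0 - y 0)]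
  rw [EuclideanSpace.dist_eq, Real.sqrt_lt' hε]
  simp only [Fin.sum_univ_two, Real.dist_eq]
  nlinarith [abs_nonneg (x 0 - y 0), abs_nonneg (x 1 - y 1)]

/-- Both points lie in the same half-open grid interval of length `η`. The bounds from `a` are
needed since the natural floor sends all negative numbers to `0`. -/
lemma abs_sub_lt_of_floor_eq {a x y η : ℝ} (hη : 0 < η) (hx : a ≤ x) (hy : a ≤ y)
    (h : ⌊(x - a) / η⌋₊ = ⌊(y - a) / η⌋₊) : |x - y| < η := by
  have hx0 := Nat.floor_le (div_nonneg (sub_nonneg.2 hx) hη.le)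
  have hy0 := Nat.floor_le (div_nonneg (sub_nonneg.2 hy) hη.le)
  have hx1 := Nat.lt_floor_add_one ((x - a) / η)
  have hy1 := Nat.lt_floor_add_one ((y - a) / η)
  rw [h] at hx0 hx1
  have hlt : |(x - a) / η - (y - a) / η| < 1 := by
    rw [abs_lt]
    constructor <;> linarith
  rwa [← sub_div, sub_sub_sub_cancel_right, abs_div, abs_of_pos hη, div_lt_one hη] at hlt

/-- A cell contains boundedly many points at pairwise distance at least `δ` times its size. -/
lemma Cell.encard_le_of_separated (b : Cell) {δ : ℝ} (hδ : 0 < δ) {S : Set Plane}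
    (hS : S ⊆ b.square) (hsep : ∀ x ∈ S, ∀ y ∈ S, x ≠ y → δ * b.size ≤ dist x y) :
    S.encard ≤ ((⌊2 / δ⌋₊ + 1) ^ 2 : ℕ) := by
  have hb := b.size_pos
  have hη : 0 < δ * b.size / 2 := by positivity
  -- Grid squares of side `δ * b.size / 2` have diameter below `δ * b.size`, so each holds at most
  -- one point of `S`. The extra `1` accounts for a last partial interval and for the closed far
  -- side of the cell.
  let N := ⌊2 / δ⌋₊ + 1
  let f : Plane → ℕ × ℕ := fun p =>
    (⌊(p 0 - b.x * b.size) / (δ * b.size / 2)⌋₊, ⌊(p 1 - b.y * b.size) / (δ * b.size / 2)⌋₊)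
  have hfloor : ∀ t a : ℝ, t ≤ (a + 1) * b.size →
      ⌊(t - a * b.size) / (δ * b.size / 2)⌋₊ < N := by
    intro t a ht
    refine Nat.lt_succ_of_le (Nat.floor_le_floor ?_)
    rw [div_le_div_iff₀ hη hδ]
    nlinarith
  have hmaps : Set.MapsTo f S (Finset.range N ×ˢ Finset.range N : Finset (ℕ × ℕ)) := by
    intro p hp
    obtain ⟨-, h0, -, h1⟩ := hS hp
    simpa [f] using ⟨hfloor _ _ h0, hfloor _ _ h1⟩
  have hinj : Set.InjOn f S := by
    intro x hx y hy hxy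
    by_contra hne
    obtain ⟨h0, h1⟩ := Prod.ext_iff.1 hxy
    have hx' := hS hx
    have hy' := hS hy
    refine (hsep x hx y hy hne).not_gt (dist_lt_of_abs_lt fun k => ?_)
    fin_cases k
    · exact abs_sub_lt_of_floor_eq hη hx'.1 hy'.1 h0
    · exact abs_sub_lt_of_floor_eq hη hx'.2.2.1 hy'.2.2.1 h1
  refine (Set.encard_le_encard_of_injOn hmaps hinj).trans_eq ?_
  rw [Set.encard_coe_eq_coe_finsetCard, Finset.card_product, Finset.card_range, sq]

end DelaunayQT

theorem mainTheorem6 (C : DelaunayQT.Consts) (hβ : Real.sqrt 2 ≤ C.β) (hlow : 0 < C.cLow)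
    (hup : 2 * C.cLow ≤ C.cUp) (hshrink : 0 < C.cShrink) :
    ∃ K : ℕ, ∀ (Ω : Set DelaunayQT.Plane) (QT : DelaunayQT.Quadtree) (s : DelaunayQT.State),
      Ω.Finite → Ω ⊆ DelaunayQT.innerSquare → QT.Balanced → DelaunayQT.Occurs C QT Ω s →
      ∀ (i : ℕ) (b : DelaunayQT.Cell), s.level + i = QT.depth →
        b ∈ QT.nodes → b.depth + i = QT.depth →
        {p | s.Active C p b.depth ∧ p ∈ b.square}.encard ≤ K := by
  -- This is the separation of active vertices relative to `b.size`; it depends on the constants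
  -- alone, hence so does `K`.
  have hδ : 0 < C.cLow * (1 / 2 : ℝ) ^ C.cSpan := by positivity
  refine ⟨_, fun Ω QT s _ _ _ hs i b _ _ _ =>
    b.encard_le_of_separated hδ (fun p hp => hp.2) fun x hx y hy hne => ?_⟩
  rw [mul_assoc]
  rcases hs.separated x hx.1.1 y hy.1.1 hne with h | h
  · exact (mul_le_mul_of_nonneg_left hx.1.le_size hlow.le).trans h
  · exact (mul_le_mul_of_nonneg_left hy.1.le_size hlow.le).trans h
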